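/- Let $\mathcal N$ be a finite set of consumers and $\mathcal T$ a finite set of time periods. For each $n\in\mathcal N$ let $E_n\in\mathbb R$ and let bounds $0\le\underline\ell_{n,t}\le\overline\ell_{n,t}$ ($t\in\mathcal T$) be given such that the feasible set $$\mathcal L_n=\Big\{\boldsymbol\ell_n\in\mathbb R^{\mathcal T}:\ \sum_{t\in\mathcal T}\ell_{n,t}=E_n,\ \ \underline\ell_{n,t}\le\ell_{n,t}\le\overline\ell_{n,t}\ \text{ for all } t\in\mathcal T\Big\}$$ is nonempty. For each $t\in\mathcal T$ let the price function $c_t:[0,\infty)\to\mathbb R$ be twice differentiable (one-sidedly at $0$), strictly increasing and convex. For a profile $\boldsymbol\ell=(\boldsymbol\ell_n)_{n\in\mathcal N}$ put $L_t=\sum_{n\in\mathcal N}\ell_{n,t}$ and let the bill of consumer $n$ be $$b_n(\boldsymbol\ell_n,\boldsymbol\ell_{-n})=\sum_{t\in\mathcal T}\ell_{n,t}\,c_t(L_t).$$ Then the minimization game in which every consumer $n$ chooses $\boldsymbol\ell_n\in\mathcal L_n$ and pays $b_n$ has a Nash equilibrium, and it is unique: there is exactly one $\boldsymbol\ell\in\prod_{n\in\mathcal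 N}\mathcal L_n$ such that, for every $n\in\mathcal N$ and every $\boldsymbol y_n\in\mathcal L_n$, $b_n(\boldsymbol\ell_n,\boldsymbol\ell_{-n})\le b_n(\boldsymbol y_n,\boldsymbol\ell_{-n})$. -/

import Mathlib

/-- Feasible profiles of a consumer with total energy `E` and power bounds `lo`, `up`. -/
def feasibleSet {τ : Type*} [Fintype τ] (E : ℝ) (lo up : τ → ℝ) : Set (τ → ℝ) :=
  {y | ∑ t, y t = E ∧ ∀ t, lo t ≤ y t ∧ y t ≤ up t}

/-- Aggregated flexible load at period `t`: the sum over the consumers. -/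
def aggregateLoad {ν τ : Type*} [Fintype ν] (x : ν → τ → ℝ) (t : τ) : ℝ :=
  ∑ n, x n t

/-- Hourly proportional billing: consumer `n` pays the per-unit price of each period, evaluated
at the aggregated load, for her own load at that period. -/
def hourlyBill {ν τ : Type*} [Fintype ν] [Fintype τ] (c : τ → ℝ → ℝ) (n : ν)
    (x : ν → τ → ℝ) : ℝ :=
  ∑ t, x n t * c t (aggregateLoad x t)

/-- Nash equilibrium of the minimization game with strategy sets `S n` and costs `b n`. -/
def IsNashEquilibrium {ν A : Type*} [DecidableEq ν] (S : ν → Set A) (b : ν → (ν → A) → ℝ)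
    (x : ν → A) : Prop :=
  (∀ n, x n ∈ S n) ∧ ∀ n, ∀ y ∈ S n, b n x ≤ b n (Function.update x n y)

/-- A price function on nonnegative loads that is twice differentiable (one-sidedly at `0`),
strictly increasing and convex. -/
structure IsAdmissiblePrice (f : ℝ → ℝ) : Prop where
  differentiableOn : DifferentiableOn ℝ f (Set.Ici 0)
  differentiableOn_deriv : DifferentiableOn ℝ (derivWithin f (Set.Ici 0)) (Set.Ici 0)
  strictMonoOn : StrictMonoOn f (Set.Ici 0)
  convexOn : ConvexOn ℝ (Set.Ici 0) f

/-!
The bill of consumer `n` is convex in her own load, with partial derivative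
`c_t(L_t) + x_{n,t} c_t'(L_t)` in the load `x_{n,t}`. A profile is therefore an equilibrium exactly
when it solves the variational inequality for these marginal bills
(`isNashEquilibrium_iff_variational`).

*Uniqueness.* If, from one equilibrium to another, a consumer raised her load in a period where the
aggregate load does not fall and lowered it in a period where the aggregate does not rise, her
marginal bill would strictly increase in the first period and strictly decrease in the second. In
each equilibrium, however, moving load between the two periods is feasible in one direction, which
orders the marginal bills; the two orderings are incompatible with these changes
(`IsVariationalSolution.not_opposite_moves`). So on the set of periods where the aggregate strictly
rises no consumer increases her total load, and that set is empty. Hence both equilibria have the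
same aggregates, and the same dichotomy shows that the individual loads agree.

*Existence.* No fixed point theorem of Brouwer type is used. Replace `c_t'` by a strictly positive
nondecreasing `d_t`, and give each consumer a multiplier `μ_n` for her energy constraint. The load prescribed by
`μ_n` and an aggregate `L_t` is `(μ_n - c_t(L_t)) / d_t(L_t)` clamped to the bounds; it is monotone
in `μ_n` and antitone in `L_t`. The equations `∑_t (load of n at t) - E_n = 0` and
`L_t - ∑_n (load of n at t) = 0` thus form a system in the unknowns `(μ, L)` whose every component is
antitone in the other unknowns, and such a system is solved by maximizing the sum of the unknowns
over its subsolutions (`exists_eq_zero_of_antitone_off_diagonal`). Taking `d_t = c_t' + ε` and letting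
`ε → 0` along a convergent subsequence gives a solution of the variational inequality. The
regularization is needed because `c_t'(0)` may vanish.
-/

open Set Filter Topology

/-! ### Systems that are antitone off the diagonal -/

/-- A continuous system on a box, each component of which is antitone in the other unknowns, has a
zero if the lower corner is a subsolution and each component is nonnegative on its upper face. A
subsolution with maximal sum of coordinates is a zero: if `F i z < 0`, a small increase of `z i`
keeps component `i` negative and can only decrease the other components. -/
lemma exists_eq_zero_of_antitone_off_diagonal {ι : Type*} [Fintype ι] [DecidableEq ι]
    {a b : ι → ℝ} (hab : a ≤ b) {F : ι → (ι → ℝ) → ℝ} (hF : ∀ i, Continuous (F i))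
    (hanti : ∀ i z w, z ≤ w → z i = w i → F i w ≤ F i z)
    (ha : ∀ i, F i a ≤ 0) (hb : ∀ i, ∀ z ∈ Icc a b, z i = b i → 0 ≤ F i z) :
    ∃ z ∈ Icc a b, ∀ i, F i z = 0 := by
  have hK : IsCompact (Icc a b ∩ {z | ∀ i, F i z ≤ 0}) := by
    refine isCompact_Icc.inter_right ?_
    simp only [ofPred_forall]
    exact isClosed_iInter fun i => isClosed_le (hF i) continuous_const
  obtain ⟨z, ⟨hz, hFz⟩, hmax⟩ := hK.exists_isMaxOn ⟨a, ⟨le_rfl, hab⟩, ha⟩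
    (f := fun z : ι → ℝ => ∑ i, z i) (by fun_prop)
  refine ⟨z, hz, fun i => le_antisymm (hFz i) ?_⟩
  by_contra! hneg
  have hzb : z i < b i :=
    lt_of_le_of_ne (hz.2 i) fun h => absurd (hb i z hz h) hneg.not_ge
  have hcont : Continuous fun v : ℝ => F i (Function.update z i v) :=
    (hF i).comp (continuous_const.update i continuous_id)
  have hev : ∀ᶠ v in 𝓝[>] z i, F i (Function.update z i v) < 0 := by
    refine (hcont.tendsto' (z i) (F i z) (by simp)).mono_left nhdsWithin_le_nhds
      |>.eventually_lt_const hneg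
  obtain ⟨v, hv, hv'⟩ := (hev.and (Ioo_mem_nhdsGT hzb)).exists
  have hzw : z ≤ Function.update z i v := by
    intro j
    by_cases h : j = i
    · subst h; simpa using hv'.1.le
    · simp [h]
  have hw : Function.update z i v ∈ Icc a b ∩ {z | ∀ i, F i z ≤ 0} := by
    refine ⟨⟨hz.1.trans hzw, fun j => ?_⟩, fun j => ?_⟩
    · by_cases h : j = i
      · subst h; simpa using hv'.2.le
      · simpa [h] using hz.2 j
    · by_cases h : j = i
      · subst h; exact hv.le
      · exact (hanti j _ _ hzw (by simp [h])).trans (hFz j)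
  have hlt : ∑ j, z j < ∑ j, Function.update z i v j :=
    Finset.sum_lt_sum (fun j _ => hzw j) ⟨i, Finset.mem_univ i, by simpa using hv'.1⟩
  exact absurd (hmax hw) (not_le.mpr hlt)

/-! ### Loads prescribed by a multiplier -/

/-- The load in `[l, u]` prescribed by the multiplier `μ` at aggregate load `L`: the solution `X` of
`p L + X * d L = μ`, clamped to the bounds. -/
noncomputable def clampedLoad (p d : ℝ → ℝ) (l u μ L : ℝ) : ℝ :=
  max l (min u ((μ - p L) / d L))

section ClampedLoad

variable {p d : ℝ → ℝ} {l u : ℝ}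

lemma clampedLoad_mem_Icc (hlu : l ≤ u) (μ L : ℝ) : clampedLoad p d l u μ L ∈ Icc l u :=
  ⟨le_max_left _ _, max_le hlu (min_le_left _ _)⟩

lemma clampedLoad_mono_left (hd : ∀ L, 0 < d L) (L : ℝ) :
    Monotone fun μ => clampedLoad p d l u μ L := by
  intro μ μ' h
  have := (hd L).le
  simp only [clampedLoad]
  gcongr

lemma clampedLoad_anti_right (hp : Monotone p) (hdm : Monotone d) (hd : ∀ L, 0 < d L)
    (hl : 0 ≤ l) (μ : ℝ) : Antitone fun L => clampedLoad p d l u μ L := by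
  intro L L' h
  simp only [clampedLoad]
  rcases le_total (μ - p L') 0 with h0 | h0
  · -- The quotient need not be antitone where it is negative, but there the load is `l`.
    have : min u ((μ - p L') / d L') ≤ l :=
      (min_le_right _ _).trans ((div_nonpos_of_nonpos_of_nonneg h0 (hd L').le).trans hl)
    rw [max_eq_left this]
    exact le_max_left _ _
  · refine max_le_max le_rfl (min_le_min le_rfl ?_)
    exact div_le_div₀ (h0.trans (by linarith [hp h])) (by linarith [hp h]) (hd L) (hdm h)

lemma clampedLoad_of_le (hd : ∀ L, 0 < d L) (hl : 0 ≤ l) {μ L : ℝ} (h : μ ≤ p L) :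
    clampedLoad p d l u μ L = l :=
  max_eq_left ((min_le_right _ _).trans
    ((div_nonpos_of_nonpos_of_nonneg (by linarith) (hd L).le).trans hl))

lemma clampedLoad_of_ge (hd : ∀ L, 0 < d L) (hlu : l ≤ u) {μ L : ℝ}
    (h : p L + u * d L ≤ μ) : clampedLoad p d l u μ L = u := by
  have : u ≤ (μ - p L) / d L := by
    rw [le_div_iff₀ (hd L)]; linarith
  rw [clampedLoad, min_eq_left this, max_eq_right hlu]

/-- The complementary slackness conditions at the clamped load. -/
lemma clampedLoad_variational (hd : ∀ L, 0 < d L) (hlu : l ≤ u) (μ L : ℝ) {y : ℝ}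
    (hy : y ∈ Icc l u) :
    0 ≤ (p L + clampedLoad p d l u μ L * d L - μ) * (y - clampedLoad p d l u μ L) := by
  obtain ⟨r, hr⟩ : ∃ r, r = (μ - p L) / d L := ⟨_, rfl⟩
  have hμ : μ = p L + r * d L := by
    rw [hr, div_mul_cancel₀ _ (hd L).ne']; ring
  rw [clampedLoad, ← hr]
  have key : 0 ≤ (max l (min u r) - r) * (y - max l (min u r)) := by
    rcases le_total u r with h | h
    · rw [min_eq_left h, max_eq_right hlu]
      exact mul_nonneg_of_nonpos_of_nonpos (by linarith) (by linarith [hy.2])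
    · rw [min_eq_right h]
      rcases le_total l r with h' | h'
      · simp [max_eq_right h']
      · rw [max_eq_left h']
        exact mul_nonneg (by linarith) (by linarith [hy.1])
  have := mul_nonneg (hd L).le key
  calc (0 : ℝ) ≤ _ := this
    _ = _ := by rw [hμ]; ring

lemma continuous_clampedLoad (hp : Continuous p) (hdc : Continuous d) (hd : ∀ L, 0 < d L) :
    Continuous fun q : ℝ × ℝ => clampedLoad p d l u q.1 q.2 := by
  have : ∀ q : ℝ × ℝ, d q.2 ≠ 0 := fun q => (hd q.2).ne'
  unfold clampedLoad
  fun_prop (disch := assumption)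

end ClampedLoad

/-! ### Variational inequalities with strictly positive slopes -/

/-- Solvability of the variational inequality with marginal bills `p t L + x n t * d t L`, for slopes
`d` that are positive everywhere, including at `0`. -/
lemma exists_variational_of_pos {ν τ : Type*} [Fintype ν] [Fintype τ]
    {p d : τ → ℝ → ℝ} {E : ν → ℝ} {lo up : ν → τ → ℝ}
    (hpc : ∀ t, Continuous (p t)) (hpm : ∀ t, Monotone (p t))
    (hdc : ∀ t, Continuous (d t)) (hdm : ∀ t, Monotone (d t)) (hd : ∀ t L, 0 < d t L)
    (hlo : ∀ n t, 0 ≤ lo n t) (hne : ∀ n, (feasibleSet (E n) (lo n) (up n)).Nonempty) :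
    ∃ x : ν → τ → ℝ, (∀ n, x n ∈ feasibleSet (E n) (lo n) (up n)) ∧
      ∀ n, ∀ y ∈ feasibleSet (E n) (lo n) (up n),
        0 ≤ ∑ t, (p t (aggregateLoad x t) + x n t * d t (aggregateLoad x t)) * (y t - x n t) := by
  classical
  have hlu : ∀ n t, lo n t ≤ up n t := fun n t =>
    let ⟨y, hy⟩ := hne n
    (hy.2 t).1.trans (hy.2 t).2
  have hup : ∀ n t, 0 ≤ up n t := fun n t => (hlo n t).trans (hlu n t)
  -- A multiplier below `A` prescribes the lower bounds, and `B n` prescribes the upper bounds.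
  obtain ⟨A, hA⟩ : ∃ A, ∀ t, A ≤ p t 0 := by
    obtain ⟨A, hA⟩ := (Set.finite_range fun t => p t 0).bddBelow
    exact ⟨A, fun t => hA ⟨t, rfl⟩⟩
  have hB' : ∀ n, ∃ B, A ≤ B ∧ ∀ t, p t (∑ m, up m t) + up n t * d t (∑ m, up m t) ≤ B := by
    intro n
    obtain ⟨B, hB⟩ :=
      (Set.finite_range fun t => p t (∑ m, up m t) + up n t * d t (∑ m, up m t)).bddAbove
    exact ⟨max A B, le_max_left _ _, fun t => (hB ⟨t, rfl⟩).trans (le_max_right _ _)⟩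
  choose B hAB hB using hB'
  let g : ν → τ → (ν ⊕ τ → ℝ) → ℝ := fun n t z =>
    clampedLoad (p t) (d t) (lo n t) (up n t) (z (.inl n)) (z (.inr t))
  have hg : ∀ n t, Continuous (g n t) := fun n t =>
    (continuous_clampedLoad (l := lo n t) (u := up n t) (hpc t) (hdc t) (hd t)).comp
      (f := fun z : ν ⊕ τ → ℝ => (z (.inl n), z (.inr t))) (by fun_prop)
  have hgm : ∀ n t z, g n t z ∈ Icc (lo n t) (up n t) := fun n t z =>
    clampedLoad_mem_Icc (hlu n t) _ _
  obtain ⟨z, -, hz⟩ := exists_eq_zero_of_antitone_off_diagonal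
    (a := Sum.elim (fun _ : ν => A) (fun _ : τ => 0))
    (b := Sum.elim B (fun t => ∑ m, up m t))
    (F := Sum.elim (fun n z => ∑ t, g n t z - E n) (fun t z => z (.inr t) - ∑ n, g n t z))
    (by
      rintro (n | t)
      · exact hAB n
      · exact Finset.sum_nonneg fun m _ => hup m t)
    (by rintro (n | t) <;> simp only [Sum.elim_inl, Sum.elim_inr] <;> fun_prop)
    (by
      rintro (n | t) z w hzw h
      · refine sub_le_sub_right (Finset.sum_le_sum fun t _ => ?_) _
        simp only [g, h]
        exact clampedLoad_anti_right (hpm t) (hdm t) (hd t) (hlo n t) _ (hzw _)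
      · simp only [Sum.elim_inr, h]
        refine sub_le_sub_left (Finset.sum_le_sum fun n _ => ?_) _
        simp only [g, h]
        exact clampedLoad_mono_left (hd t) _ (hzw _))
    (by
      rintro (n | t)
      · obtain ⟨y, hy⟩ := hne n
        simp only [Sum.elim_inl, sub_nonpos, ← hy.1]
        refine Finset.sum_le_sum fun t _ => ?_
        simp only [g, Sum.elim_inl, Sum.elim_inr]
        rw [clampedLoad_of_le (hd t) (hlo n t) (hA t)]
        exact (hy.2 t).1
      · simp only [Sum.elim_inr, zero_sub, neg_nonpos]
        exact Finset.sum_nonneg fun n _ => (hlo n t).trans (hgm n t _).1)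
    (by
      rintro (n | t) z hz h
      · obtain ⟨y, hy⟩ := hne n
        simp only [Sum.elim_inl, sub_nonneg, ← hy.1] at h ⊢
        refine Finset.sum_le_sum fun t _ => ?_
        have hL : z (.inr t) ≤ ∑ m, up m t := hz.2 (.inr t)
        simp only [g, h]
        rw [clampedLoad_of_ge (hd t) (hlu n t)]
        · exact (hy.2 t).2
        · exact (add_le_add (hpm t hL) (mul_le_mul_of_nonneg_left (hdm t hL) (hup n t))).trans
            (hB n t)
      · simp only [Sum.elim_inr] at h ⊢
        rw [h, sub_nonneg]
        exact Finset.sum_le_sum fun n _ => (hgm n t z).2)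
  have hE : ∀ n, ∑ t, g n t z = E n := fun n => sub_eq_zero.1 (hz (.inl n))
  have hL : ∀ t, z (.inr t) = ∑ n, g n t z := fun t => sub_eq_zero.1 (hz (.inr t))
  refine ⟨fun n t => g n t z, fun n => ⟨hE n, fun t => hgm n t z⟩, fun n y hy => ?_⟩
  -- The multiplier drops out because both loads have total energy `E n`.
  have hμ : ∑ t, z (.inl n) * (y t - g n t z) = 0 := by
    rw [← Finset.mul_sum, Finset.sum_sub_distrib, hy.1, hE, sub_self, mul_zero]
  have hsum := Finset.sum_nonneg fun t (_ : t ∈ Finset.univ) =>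
    clampedLoad_variational (p := p t) (hd t) (hlu n t) (z (.inl n)) (z (.inr t)) (hy.2 t)
  simp only [sub_mul _ (z (.inl n)), Finset.sum_sub_distrib] at hsum
  simp only [aggregateLoad, ← hL]
  linarith

/-! ### Admissible prices and marginal bills -/

/-- The derivative, in the own load `X`, of the bill `X * f L` at aggregate load `L`, which contains
`X`. The derivative of `f` is taken within `[0, ∞)`. -/
noncomputable def marginalBill (f : ℝ → ℝ) (X L : ℝ) : ℝ :=
  f L + X * derivWithin f (Ici 0) L

namespace IsAdmissiblePrice

variable {f : ℝ → ℝ}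

lemma derivWithin_nonneg (hf : IsAdmissiblePrice f) (L : ℝ) : 0 ≤ derivWithin f (Ici 0) L :=
  hf.strictMonoOn.monotoneOn.derivWithin_nonneg

lemma monotoneOn_derivWithin (hf : IsAdmissiblePrice f) :
    MonotoneOn (derivWithin f (Ici 0)) (Ici 0) :=
  hf.convexOn.monotoneOn_derivWithin hf.differentiableOn

lemma tangent_le (hf : IsAdmissiblePrice f) {L M : ℝ} (hL : 0 ≤ L) (hM : 0 ≤ M) :
    f L + derivWithin f (Ici 0) L * (M - L) ≤ f M := by
  rcases lt_trichotomy L M with h | rfl | h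
  · have := hf.convexOn.derivWithin_le_slope hL hM h (hf.differentiableOn L hL)
    rw [slope_def_field, le_div_iff₀ (by linarith)] at this
    linarith
  · simp
  · have := hf.convexOn.slope_le_derivWithin hM hL h (hf.differentiableOn L hL)
    rw [slope_def_field, div_le_iff₀ (by linarith)] at this
    linarith

lemma derivWithin_pos (hf : IsAdmissiblePrice f) {L : ℝ} (hL : 0 < L) :
    0 < derivWithin f (Ici 0) L := by
  have h1 := hf.tangent_le hL.le le_rfl
  have h2 := hf.strictMonoOn self_mem_Ici hL.le hL
  exact pos_of_mul_pos_left (by linarith : 0 < derivWithin f (Ici 0) L * L) hL.le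

/-- The marginal bill strictly increases with the own load if the aggregate does not decrease. The
positivity of the new load excludes the point `0`, where the derivative may vanish. -/
lemma marginalBill_lt (hf : IsAdmissiblePrice f) {X Y L M : ℝ} (hX : 0 ≤ X) (hXY : X < Y)
    (hL : 0 ≤ L) (hLM : L ≤ M) (hYM : Y ≤ M) : marginalBill f X L < marginalBill f Y M := by
  have hM : 0 < M := by linarith
  have h1 : f L ≤ f M := hf.strictMonoOn.monotoneOn hL hM.le hLM
  have h2 := hf.monotoneOn_derivWithin hL hM.le hLM
  have h3 := hf.derivWithin_pos hM
  have h4 := mul_le_mul_of_nonneg_left h2 hX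
  have h5 := mul_lt_mul_of_pos_right hXY h3
  simp only [marginalBill]
  linarith

/-- Convexity of the bill of one period in the own load, as a tangent inequality. -/
lemma bill_tangent_le (hf : IsAdmissiblePrice f) {X Y L : ℝ} (hX : 0 ≤ X) (hL : 0 ≤ L)
    (hM : 0 ≤ L + (Y - X)) :
    X * f L + marginalBill f X L * (Y - X) ≤ Y * f (L + (Y - X)) := by
  have h1 := mul_le_mul_of_nonneg_left (hf.tangent_le hL hM) hX
  have h2 : 0 ≤ (Y - X) * (f (L + (Y - X)) - f L) := by
    rcases le_total X Y with h | h
    · exact mul_nonneg (by linarith)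
        (sub_nonneg.2 (hf.strictMonoOn.monotoneOn hL hM (by linarith)))
    · exact mul_nonneg_of_nonpos_of_nonpos (by linarith)
        (sub_nonpos.2 (hf.strictMonoOn.monotoneOn hM hL (by linarith)))
  simp only [marginalBill]
  linarith

lemma hasDerivWithinAt_bill (hf : IsAdmissiblePrice f) {X L D : ℝ} (hL : 0 ≤ L)
    (hD : 0 ≤ L + D) :
    HasDerivWithinAt (fun θ => (X + θ * D) * f (L + θ * D)) (marginalBill f X L * D)
      (Icc 0 1) 0 := by
  have hlin : ∀ c : ℝ, HasDerivWithinAt (fun θ : ℝ => c + θ * D) D (Icc 0 1) 0 := fun c => by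
    simpa using ((hasDerivAt_id (0 : ℝ)).mul_const D |>.const_add c).hasDerivWithinAt
  have hmaps : MapsTo (fun θ : ℝ => L + θ * D) (Icc 0 1) (Ici 0) := by
    intro θ hθ
    show 0 ≤ L + θ * D
    nlinarith [mul_nonneg hθ.1 hD, mul_nonneg (sub_nonneg.2 hθ.2) hL]
  have hf' : HasDerivWithinAt f (derivWithin f (Ici 0) L) (Ici 0) (L + 0 * D) := by
    simpa using (hf.differentiableOn L hL).hasDerivWithinAt
  have h := (hlin X).mul (hf'.comp (0 : ℝ) (hlin L) hmaps)
  refine h.congr_deriv ?_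
  simp only [marginalBill, Function.comp_apply, zero_mul, add_zero]
  ring

end IsAdmissiblePrice

/-! ### Equilibria as solutions of a variational inequality -/

section Game

variable {ν τ : Type*} {c : τ → ℝ → ℝ}
  {E : ν → ℝ} {lo up : ν → τ → ℝ}

lemma nonneg_of_mem_feasibleSet [Fintype τ] (hlo : ∀ n t, 0 ≤ lo n t) {n : ν} {y : τ → ℝ}
    (hy : y ∈ feasibleSet (E n) (lo n) (up n)) (t : τ) : 0 ≤ y t :=
  (hlo n t).trans (hy.2 t).1

lemma convex_feasibleSet [Fintype τ] (e : ℝ) (l u : τ → ℝ) : Convex ℝ (feasibleSet e l u) := by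
  intro y hy z hz a b ha hb hab
  refine ⟨?_, fun t => ?_⟩
  · simp only [Pi.add_apply, Pi.smul_apply, smul_eq_mul, Finset.sum_add_distrib,
      ← Finset.mul_sum, hy.1, hz.1]
    rw [← add_mul, hab, one_mul]
  · exact (convex_Icc (l t) (u t)) (hy.2 t) (hz.2 t) ha hb hab

lemma isCompact_feasibleSet [Fintype τ] (e : ℝ) (l u : τ → ℝ) : IsCompact (feasibleSet e l u) := by
  have : feasibleSet e l u = Icc l u ∩ {y | ∑ t, y t = e} := by
    ext y
    simp only [feasibleSet, mem_ofPred_eq, mem_inter_iff, mem_Icc, Pi.le_def, forall_and]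
    tauto
  rw [this]
  exact isCompact_Icc.inter_right (isClosed_eq (by fun_prop) continuous_const)

lemma aggregateLoad_nonneg [Fintype ν] {x : ν → τ → ℝ} (hx : ∀ n t, 0 ≤ x n t) (t : τ) :
    0 ≤ aggregateLoad x t :=
  Finset.sum_nonneg fun n _ => hx n t

lemma le_aggregateLoad [Fintype ν] {x : ν → τ → ℝ} (hx : ∀ n t, 0 ≤ x n t) (n : ν) (t : τ) :
    x n t ≤ aggregateLoad x t :=
  Finset.single_le_sum (f := fun n => x n t) (fun m _ => hx m t) (Finset.mem_univ n)

lemma aggregateLoad_update [Fintype ν] [DecidableEq ν] (x : ν → τ → ℝ) (n : ν) (y : τ → ℝ) (t : τ) :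
    aggregateLoad (Function.update x n y) t = aggregateLoad x t + (y t - x n t) := by
  rw [← sub_eq_iff_eq_add', aggregateLoad, aggregateLoad, ← Finset.sum_sub_distrib,
    Finset.sum_eq_single n]
  · simp
  · intro m _ hm
    simp [hm]
  · simp

variable [Fintype ν] [Fintype τ]

/-- A feasible profile at which, for every consumer, no feasible deviation decreases her bill to
first order. -/
def IsVariationalSolution (c : τ → ℝ → ℝ) (S : ν → Set (τ → ℝ)) (x : ν → τ → ℝ) : Prop :=
  (∀ n, x n ∈ S n) ∧
    ∀ n, ∀ y ∈ S n, 0 ≤ ∑ t, marginalBill (c t) (x n t) (aggregateLoad x t) * (y t - x n t)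

lemma hourlyBill_update [DecidableEq ν] (x : ν → τ → ℝ) (n : ν) (y : τ → ℝ) :
    hourlyBill c n (Function.update x n y)
      = ∑ t, y t * c t (aggregateLoad x t + (y t - x n t)) := by
  simp [hourlyBill, aggregateLoad_update]

theorem isNashEquilibrium_iff_variational [DecidableEq ν] (hc : ∀ t, IsAdmissiblePrice (c t))
    (hlo : ∀ n t, 0 ≤ lo n t) (x : ν → τ → ℝ) :
    IsNashEquilibrium (fun n => feasibleSet (E n) (lo n) (up n)) (hourlyBill c) x ↔
      IsVariationalSolution c (fun n => feasibleSet (E n) (lo n) (up n)) x := by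
  refine and_congr_right fun hx => forall_congr' fun n => ?_
  have hx0 : ∀ n t, 0 ≤ x n t := fun n => nonneg_of_mem_feasibleSet hlo (hx n)
  have hM0 : ∀ y ∈ feasibleSet (E n) (lo n) (up n), ∀ t,
      0 ≤ aggregateLoad x t + (y t - x n t) := fun y hy t => by
    linarith [le_aggregateLoad hx0 n t, nonneg_of_mem_feasibleSet hlo hy t]
  constructor
  · intro h y hy
    -- The bill on the segment from `x n` to `y` is minimal at `x n`.
    let φ : ℝ → ℝ := fun θ => ∑ t, (x n t + θ * (y t - x n t)) *
      c t (aggregateLoad x t + θ * (y t - x n t))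
    have hφ : HasDerivWithinAt φ
        (∑ t, marginalBill (c t) (x n t) (aggregateLoad x t) * (y t - x n t)) (Icc 0 1) 0 :=
      HasDerivWithinAt.fun_sum fun t _ =>
        (hc t).hasDerivWithinAt_bill (aggregateLoad_nonneg hx0 t) (hM0 y hy t)
    have hmin : IsMinOn φ (Icc 0 1) 0 := by
      intro θ hθ
      have hz : x n + θ • (y - x n) ∈ feasibleSet (E n) (lo n) (up n) :=
        (convex_feasibleSet _ _ _).add_smul_sub_mem (hx n) hy hθ
      have := h _ hz
      rw [hourlyBill_update] at this
      simpa [φ, hourlyBill] using this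
    have hone : (1 : ℝ) ∈ posTangentConeAt (Icc (0 : ℝ) 1) 0 :=
      mem_posTangentConeAt_of_segment_subset (by simp [segment_eq_Icc])
    simpa using hmin.localize.hasFDerivWithinAt_nonneg hφ.hasFDerivWithinAt hone
  · intro h y hy
    rw [hourlyBill_update]
    have hsum := Finset.sum_le_sum fun t (_ : t ∈ Finset.univ) =>
      (hc t).bill_tangent_le (hx0 n t) (aggregateLoad_nonneg hx0 t) (hM0 y hy t)
    rw [Finset.sum_add_distrib] at hsum
    have := h y hy
    simp only [hourlyBill]
    linarith

/-! ### Uniqueness -/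

/-- At a solution, load cannot be moved from a period with a larger marginal bill to a period with a
smaller one. -/
lemma IsVariationalSolution.marginalBill_le
    {x : ν → τ → ℝ} (hx : IsVariationalSolution c (fun n => feasibleSet (E n) (lo n) (up n)) x)
    {n : ν} {s t : τ} (hs : lo n s < x n s) (ht : x n t < up n t) :
    marginalBill (c s) (x n s) (aggregateLoad x s)
      ≤ marginalBill (c t) (x n t) (aggregateLoad x t) := by
  classical
  rcases eq_or_ne s t with rfl | hst
  · exact le_rfl
  obtain ⟨ε, hε, hεs, hεt⟩ : ∃ ε > 0, ε ≤ x n s - lo n s ∧ ε ≤ up n t - x n t :=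
    ⟨min (x n s - lo n s) (up n t - x n t), lt_min (by linarith) (by linarith),
      min_le_left _ _, min_le_right _ _⟩
  have hxn := hx.1 n
  have hy : x n + (Pi.single t ε - Pi.single s ε) ∈ feasibleSet (E n) (lo n) (up n) := by
    refine ⟨?_, fun r => ?_⟩
    · simp [Finset.sum_add_distrib, hxn.1]
    · have hr := hxn.2 r
      rcases eq_or_ne r t with rfl | hrt
      · simp only [Pi.add_apply, Pi.sub_apply, Pi.single_eq_same, Pi.single_eq_of_ne hst.symm]
        constructor <;> linarith
      · rcases eq_or_ne r s with rfl | hrs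
        · simp only [Pi.add_apply, Pi.sub_apply, Pi.single_eq_same, Pi.single_eq_of_ne hst]
          constructor <;> linarith
        · simpa [hrt, hrs] using hr
  have h := hx.2 n _ hy
  simp only [Pi.add_apply, Pi.sub_apply, add_sub_cancel_left, mul_sub,
    Finset.sum_sub_distrib] at h
  simp only [Pi.single_apply, mul_ite, mul_zero, Finset.sum_ite_eq', Finset.mem_univ,
    if_true, ← sub_mul] at h
  exact sub_nonneg.1 (nonneg_of_mul_nonneg_left h hε)

/-- Between two solutions, no consumer both raises her load in a period whose aggregate does not
fall and lowers it in a period whose aggregate does not rise. -/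
lemma IsVariationalSolution.not_opposite_moves (hc : ∀ t, IsAdmissiblePrice (c t))
    (hlo : ∀ n t, 0 ≤ lo n t) {x x' : ν → τ → ℝ}
    (hx : IsVariationalSolution c (fun n => feasibleSet (E n) (lo n) (up n)) x)
    (hx' : IsVariationalSolution c (fun n => feasibleSet (E n) (lo n) (up n)) x')
    {n : ν} {s t : τ} (hLt : aggregateLoad x t ≤ aggregateLoad x' t) (ht : x n t < x' n t)
    (hLs : aggregateLoad x' s ≤ aggregateLoad x s) : x n s ≤ x' n s := by
  by_contra! hs
  have h0 : ∀ n t, 0 ≤ x n t := fun n => nonneg_of_mem_feasibleSet hlo (hx.1 n)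
  have h0' : ∀ n t, 0 ≤ x' n t := fun n => nonneg_of_mem_feasibleSet hlo (hx'.1 n)
  have h1 := (hc t).marginalBill_lt (h0 n t) ht (aggregateLoad_nonneg h0 t) hLt
    (le_aggregateLoad h0' n t)
  have h2 := (hc s).marginalBill_lt (h0' n s) hs (aggregateLoad_nonneg h0' s) hLs
    (le_aggregateLoad h0 n s)
  have h3 := hx.marginalBill_le (((hx'.1 n).2 s).1.trans_lt hs) (ht.trans_le ((hx'.1 n).2 t).2)
  have h4 := hx'.marginalBill_le (((hx.1 n).2 t).1.trans_lt ht) (hs.trans_le ((hx.1 n).2 s).2)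
  linarith

lemma IsVariationalSolution.aggregateLoad_le (hc : ∀ t, IsAdmissiblePrice (c t))
    (hlo : ∀ n t, 0 ≤ lo n t) {x x' : ν → τ → ℝ}
    (hx : IsVariationalSolution c (fun n => feasibleSet (E n) (lo n) (up n)) x)
    (hx' : IsVariationalSolution c (fun n => feasibleSet (E n) (lo n) (up n)) x') (t : τ) :
    aggregateLoad x' t ≤ aggregateLoad x t := by
  classical
  by_contra! hlt
  set T : Finset τ := Finset.univ.filter fun t => aggregateLoad x t < aggregateLoad x' t with hT
  have hpos : ∑ t ∈ T, aggregateLoad x t < ∑ t ∈ T, aggregateLoad x' t :=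
    Finset.sum_lt_sum_of_nonempty ⟨t, by simpa [hT] using hlt⟩ fun t ht => by
      simpa [hT] using ht
  have hle : ∀ n, ∑ t ∈ T, x' n t ≤ ∑ t ∈ T, x n t := by
    intro n
    by_cases h : ∃ t ∈ T, x n t < x' n t
    · -- Then the load outside `T` does not decrease, and the total energy is fixed.
      obtain ⟨t, ht, htx⟩ := h
      have hout : ∑ s ∈ Tᶜ, x n s ≤ ∑ s ∈ Tᶜ, x' n s :=
        Finset.sum_le_sum fun s hs => hx.not_opposite_moves hc hlo hx'
          (by simpa [hT] using (Finset.mem_filter.1 ht).2.le) htx (by simpa [hT] using hs)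
      have e : ∑ t, x n t = E n := (hx.1 n).1
      have e' : ∑ t, x' n t = E n := (hx'.1 n).1
      rw [← Finset.sum_add_sum_compl T] at e e'
      linarith
    · push Not at h
      exact Finset.sum_le_sum h
  simp only [aggregateLoad] at hpos
  rw [Finset.sum_comm, Finset.sum_comm (s := T)] at hpos
  exact absurd (Finset.sum_le_sum fun n _ => hle n) (not_le.mpr hpos)

theorem IsVariationalSolution.unique (hc : ∀ t, IsAdmissiblePrice (c t))
    (hlo : ∀ n t, 0 ≤ lo n t) {x x' : ν → τ → ℝ}
    (hx : IsVariationalSolution c (fun n => feasibleSet (E n) (lo n) (up n)) x)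
    (hx' : IsVariationalSolution c (fun n => feasibleSet (E n) (lo n) (up n)) x') : x' = x := by
  have hL : ∀ t, aggregateLoad x t = aggregateLoad x' t := fun t =>
    le_antisymm (hx'.aggregateLoad_le hc hlo hx t) (hx.aggregateLoad_le hc hlo hx' t)
  funext n
  have hsum : ∑ t, x' n t = ∑ t, x n t := (hx'.1 n).1.trans (hx.1 n).1.symm
  have hle : ∀ t, x' n t ≤ x n t := by
    by_contra! h
    obtain ⟨t, ht⟩ := h
    have hge : ∀ s, x n s ≤ x' n s := fun s =>
      hx.not_opposite_moves hc hlo hx' (hL t).le ht (hL s).ge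
    exact (Finset.sum_lt_sum (fun s _ => hge s) ⟨t, Finset.mem_univ t, ht⟩).ne' hsum
  funext t
  exact (Finset.sum_eq_sum_iff_of_le fun s _ => hle s).1 hsum t (Finset.mem_univ t)

/-! ### Existence -/

theorem exists_isVariationalSolution (hc : ∀ t, IsAdmissiblePrice (c t))
    (hlo : ∀ n t, 0 ≤ lo n t) (hne : ∀ n, (feasibleSet (E n) (lo n) (up n)).Nonempty) :
    ∃ x, IsVariationalSolution c (fun n => feasibleSet (E n) (lo n) (up n)) x := by
  -- Precomposition with `max · 0` extends the price and its derivative to the whole line.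
  let p : τ → ℝ → ℝ := fun t L => c t (max L 0)
  let q : τ → ℝ → ℝ := fun t L => derivWithin (c t) (Ici 0) (max L 0)
  have hmax : Continuous fun L : ℝ => max L 0 := by fun_prop
  have hpc : ∀ t, Continuous (p t) := fun t =>
    (hc t).differentiableOn.continuousOn.comp_continuous hmax fun L => le_max_right L 0
  have hqc : ∀ t, Continuous (q t) := fun t =>
    (hc t).differentiableOn_deriv.continuousOn.comp_continuous hmax fun L => le_max_right L 0
  have hpm : ∀ t, Monotone (p t) := fun t L M h =>
    (hc t).strictMonoOn.monotoneOn (le_max_right L 0) (le_max_right M 0) (max_le_max_right 0 h)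
  have hqm : ∀ t, Monotone (q t) := fun t L M h =>
    (hc t).monotoneOn_derivWithin (le_max_right L 0) (le_max_right M 0) (max_le_max_right 0 h)
  have hreg : ∀ k : ℕ, ∃ x : ν → τ → ℝ, (∀ n, x n ∈ feasibleSet (E n) (lo n) (up n)) ∧
      ∀ n, ∀ y ∈ feasibleSet (E n) (lo n) (up n),
        0 ≤ ∑ t, (p t (aggregateLoad x t)
          + x n t * (q t (aggregateLoad x t) + 1 / ((k : ℝ) + 1))) * (y t - x n t) := fun k =>
    exists_variational_of_pos (d := fun t L => q t L + 1 / ((k : ℝ) + 1)) hpc hpm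
      (fun t => (hqc t).add continuous_const) (fun t => (hqm t).add_const _)
      (fun t L => add_pos_of_nonneg_of_pos ((hc t).derivWithin_nonneg _)
        Nat.one_div_pos_of_nat) hlo hne
  choose x hxS hx using hreg
  obtain ⟨a, ha, φ, hφ, hlim⟩ :=
    (isCompact_univ_pi fun n => isCompact_feasibleSet (E n) (lo n) (up n)).tendsto_subseq
      (x := x) fun k n _ => hxS k n
  have haS : ∀ n, a n ∈ feasibleSet (E n) (lo n) (up n) := fun n => ha n (mem_univ n)
  have ha0 : ∀ t, max (aggregateLoad a t) 0 = aggregateLoad a t := fun t =>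
    max_eq_left (aggregateLoad_nonneg (fun n => nonneg_of_mem_feasibleSet hlo (haS n)) t)
  refine ⟨a, haS, fun n y hy => ?_⟩
  have hG : Continuous fun w : (ν → τ → ℝ) × ℝ => ∑ t, (p t (aggregateLoad w.1 t)
      + w.1 n t * (q t (aggregateLoad w.1 t) + w.2)) * (y t - w.1 n t) := by
    unfold aggregateLoad
    fun_prop
  have hw : Tendsto (fun k => (x (φ k), 1 / ((φ k : ℝ) + 1))) atTop (𝓝 (a, 0)) :=
    hlim.prodMk_nhds (tendsto_one_div_add_atTop_nhds_zero_nat.comp hφ.tendsto_atTop)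
  have h := ge_of_tendsto' ((hG.tendsto _).comp hw) fun k => hx (φ k) n y hy
  simpa only [p, q, ha0, add_zero, marginalBill] using h

end Game

theorem theorem1 {ν τ : Type*} [Fintype ν] [DecidableEq ν] [Fintype τ]
    (c : τ → ℝ → ℝ) (E : ν → ℝ) (lo up : ν → τ → ℝ)
    (hc : ∀ t, IsAdmissiblePrice (c t))
    (hlo : ∀ n t, 0 ≤ lo n t)
    (hne : ∀ n, (feasibleSet (E n) (lo n) (up n)).Nonempty) :
    ∃! x : ν → τ → ℝ,
      IsNashEquilibrium (fun n => feasibleSet (E n) (lo n) (up n)) (hourlyBill c) x := by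
  obtain ⟨x, hx⟩ := exists_isVariationalSolution hc hlo hne
  refine ⟨x, (isNashEquilibrium_iff_variational hc hlo x).2 hx, fun x' hx' => ?_⟩
  exact hx.unique hc hlo ((isNashEquilibrium_iff_variational hc hlo x').1 hx')
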